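/- \textbf{Setting.} Let $t\ge 2$, let $\mathcal X$ be a finite set, let $X$ be an $\mathcal X$-valued random variable, and let $q$ be the law on $\mathcal X^t$ of $(X_1,\dots,X_t)$ with $X_1=\dots=X_t=X$. Let $H(X)=-\sum_x \Pr(X=x)\log_2\Pr(X=x)$. Write $[1:a]$ for the set of positive integers that are at most $a$. In the \emph{randomness-on-the-forehead model} there are independent random variables $W_1,\dots,W_t$, where $W_j$ is uniform on $[1:2^{nR_j}]$. A coordinator observes $W_1,\dots,W_t$ and produces a message $M\in[1:2^{nR}]$ according to a conditional p.m.f. $p(m|w_1,\dots,w_t)$. Processor $i\in[1:t]$ observes $M$ and all $W_j$ with $j\neq i$, and produces $X_i^n\in\mathcal X^n$ according to a conditional p.m.f. $p(x_i^n|m,(w_j)_{j\ne i})$. Such a choice of conditional p.m.f.s is an $(n,2^{nR},2^{nR_1},\dots,2^{nR_t})$ \emph{simulation code}; the law of the outputs that it induces is $$p(x_1^n,\dots,x_t^n)=\sum_{w_1,\dots,w_t,m}\Big(\prod_{j=1}^t \big|[1:2^{nR_j}]\big|^{-1}\Big)\,p(m|w_1,\dots,w_t)\prod_{i=1}^t p\big(x_i^n|m,(w_j)_{j\neq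 i}\big).$$ A tuple $(R,R_1,\dots,R_t)$ of non-negative reals is \emph{achievable} for $q$ if there is a sequence of $(n,2^{nR},2^{nR_1},\dots,2^{nR_t})$ simulation codes whose induced output laws $p^{(n)}$ satisfy $\lim_{n\to\infty}\|p^{(n)}-q^{(n)}\|_1=0$, where $q^{(n)}(x_1^n,\dots,x_t^n)=\prod_{k=1}^n q(x_{1k},\dots,x_{tk})$. The \emph{simulation rate region} $\mathcal R^{\mathrm{Forehead}}$ is the closure in $\mathbb R^{t+1}$ of the set of achievable tuples. \textbf{Theorem.} $\mathcal R^{\mathrm{Forehead}}$ is the set of all tuples $(R,R_1,\dots,R_t)$ of non-negative reals such that $$iR+\sum_{j\in\mathcal S}R_j\ \ge\ H(X)\qquad\text{for all } i\in[1:t] \text{ and all } \mathcal S\subsetneq[1:t] \text{ with } |\mathcal S|=t-i.$$ -/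

import Mathlib

noncomputable section

/-- The number of elements of the index set `[1 : 2 ^ (n r)]`, that is, the number of
positive integers that are at most `2 ^ (n r)`. -/
def indexCount (n : ℕ) (r : ℝ) : ℕ := ⌊(2 : ℝ) ^ ((n : ℝ) * r)⌋₊

/-- An `(n, 2^{nR}, 2^{nR_1}, …, 2^{nR_h})` simulation code for the omniscient coordinator setting
with `t` processors and `h` independent sources of shared randomness, where processor `i` observes
the sources `W_j`, `j ∈ V i`.  The coordinator sees all the sources and randomizes privately to
produce the message; processor `i` randomizes privately, given the message and the sources that it
observes, to produce a word of length `n` over its alphabet `𝒳 i`. -/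
structure SimulationCode {t h : ℕ} (V : Fin t → Finset (Fin h)) (𝒳 : Fin t → Type*)
    (n : ℕ) (R : ℝ) (Rs : Fin h → ℝ) where
  /-- `p(m | w_1, …, w_h)` -/
  encoder : (∀ j : Fin h, Fin (indexCount n (Rs j))) → PMF (Fin (indexCount n R))
  /-- `p(x_i^n | m, w_{V_i})` -/
  decoder : ∀ i : Fin t, Fin (indexCount n R) →
    (∀ j : {j : Fin h // j ∈ V i}, Fin (indexCount n (Rs j.1))) → PMF (Fin n → 𝒳 i)

/-- The joint law of `(W_1, …, W_h, M, X_1^n, …, X_t^n)`: the sources are independent, `W_j` being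
uniform on its index set. -/
def SimulationCode.joint {t h : ℕ} {V : Fin t → Finset (Fin h)} {𝒳 : Fin t → Type*}
    {n : ℕ} {R : ℝ} {Rs : Fin h → ℝ} (c : SimulationCode V 𝒳 n R Rs)
    (w : ∀ j : Fin h, Fin (indexCount n (Rs j))) (m : Fin (indexCount n R))
    (x : ∀ i : Fin t, Fin n → 𝒳 i) : ℝ :=
  (∏ j : Fin h, ((indexCount n (Rs j) : ℝ))⁻¹) * (c.encoder w m).toReal *
    ∏ i : Fin t, (c.decoder i m (fun j => w j.1) (x i)).toReal

/-- The law of the outputs `(X_1^n, …, X_t^n)` induced by a simulation code. -/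
def SimulationCode.induced {t h : ℕ} {V : Fin t → Finset (Fin h)} {𝒳 : Fin t → Type*}
    {n : ℕ} {R : ℝ} {Rs : Fin h → ℝ} (c : SimulationCode V 𝒳 n R Rs)
    (x : ∀ i : Fin t, Fin n → 𝒳 i) : ℝ :=
  ∑ w : (∀ j : Fin h, Fin (indexCount n (Rs j))), ∑ m : Fin (indexCount n R), c.joint w m x

/-- The i.i.d. target law `q^{(n)}(x_1^n, …, x_t^n) = ∏_k q(x_{1k}, …, x_{tk})`. -/
def iidTarget {t : ℕ} {𝒳 : Fin t → Type*} (q : PMF (∀ i, 𝒳 i)) (n : ℕ)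
    (x : ∀ i : Fin t, Fin n → 𝒳 i) : ℝ :=
  ∏ k : Fin n, (q (fun i => x i k)).toReal

/-- A non-negative rate tuple `(R, R_1, …, R_h)` is achievable for `q` if there is a sequence of
simulation codes, one for each block length, whose induced output laws approach the i.i.d. law of
`q` in `ℓ¹` distance. -/
def Achievable {t h : ℕ} (V : Fin t → Finset (Fin h)) {𝒳 : Fin t → Type*} [∀ i, Fintype (𝒳 i)]
    (q : PMF (∀ i, 𝒳 i)) (r : ℝ × (Fin h → ℝ)) : Prop :=
  0 ≤ r.1 ∧ (∀ j, 0 ≤ r.2 j) ∧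
    ∃ c : ∀ n : ℕ, SimulationCode V 𝒳 n r.1 r.2,
      Filter.Tendsto
        (fun n : ℕ => ∑ x : (∀ i : Fin t, Fin n → 𝒳 i), |(c n).induced x - iidTarget q n x|)
        Filter.atTop (nhds 0)

/-- The simulation rate region: the closure of the set of achievable rate tuples. -/
def simulationRateRegion {t h : ℕ} (V : Fin t → Finset (Fin h)) {𝒳 : Fin t → Type*}
    [∀ i, Fintype (𝒳 i)] (q : PMF (∀ i, 𝒳 i)) : Set (ℝ × (Fin h → ℝ)) :=
  closure {r | Achievable V q r}

/-- Randomness on the forehead: there are as many sources as processors, and processor `i` observes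
every source except the `i`-th. -/
def foreheadAccess (t : ℕ) (i : Fin t) : Finset (Fin t) := Finset.univ \ {i}

/-- The simulation rate region of the randomness-on-the-forehead model. -/
def foreheadRegion {t : ℕ} {𝒳 : Fin t → Type*} [∀ i, Fintype (𝒳 i)] (q : PMF (∀ i, 𝒳 i)) :
    Set (ℝ × (Fin t → ℝ)) :=
  simulationRateRegion (foreheadAccess t) q

/-- Shannon entropy, in bits, of a probability mass function on a finite set
(with `0 log 0 = 0`). -/
def shannonEntropy {α : Type*} [Fintype α] (p : PMF α) : ℝ :=
  ∑ a : α, -((p a).toReal * Real.logb 2 (p a).toReal)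

end

/-!
Converse: given the message, a word that all the processors output with probability larger than
`1 / 2` belongs, for every `j`, to a list that processor `j` forms from the messages, and this list
does not depend on the source `W_j`; over all words, the sizes of the lists of a processor add up to
at most the number of messages. For each set `U` of processors, Finner's inequality for these lists
bounds the probability that the outputs agree on a word of small probability by
`(κ ∏_{j ∉ U} 2^{nR_j})^{1 / #U} 2^{nR}`, where `κ` bounds the probabilities of the words. By
typicality `κ` is about `2^{-nH(X)}`, so if the inequality of `S = Uᶜ` failed this bound would tend
to `0`, whereas the outputs have to agree with probability close to `1`.

Achievability: with `j₀` a source of maximal rate, let `a` be about `2^{n min(R, R_{j₀})}`. The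
message is the sum modulo `a` of all the sources, completed with fresh randomness up to rate `R`.
Every processor recovers the residue of the only source that it does not see, so all the processors
share an almost uniform variable of rate `R + ∑_{j ≠ j₀} min(R, R_j)`. This rate is
`#Sᶜ R + ∑_{j ∈ S} R_j` for a suitable `S ≠ [1 : t]`, hence it exceeds `H(X)` when all the
inequalities are strict, and a common function of the variable then approximates the law of `X^n`.
-/

open Filter Finset MeasureTheory ProbabilityTheory Topology
open scoped ENNReal

section FinitePMF

variable {A B : Type*} [Fintype A]

lemma sum_pmf_eq_one (p : PMF A) : ∑ a, p a = 1 := by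
  rw [← tsum_fintype (L := .unconditional _), p.tsum_coe]

lemma sum_toReal_pmf_eq_one (p : PMF A) : ∑ a, (p a).toReal = 1 := by
  rw [← ENNReal.toReal_sum fun a _ ↦ p.apply_ne_top a, sum_pmf_eq_one, ENNReal.toReal_one]

lemma toReal_pmf_map_apply [DecidableEq B] (p : PMF A) (f : A → B) (b : B) :
    (p.map f b).toReal = ∑ a with f a = b, (p a).toReal := by
  rw [PMF.map_apply, tsum_fintype, sum_filter, ENNReal.toReal_sum fun a _ ↦ by
    split_ifs <;> simp [PMF.apply_ne_top]]
  refine sum_congr rfl fun a _ ↦ ?_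
  simp only [eq_comm (a := b), apply_ite ENNReal.toReal, ENNReal.toReal_zero]

lemma sum_toReal_pmf_map_mul [Fintype B] (p : PMF A) (f : A → B) (F : B → ℝ) :
    ∑ b, (p.map f b).toReal * F b = ∑ a, (p a).toReal * F (f a) := by
  classical
  rw [← sum_fiberwise univ f]
  refine sum_congr rfl fun b _ ↦ ?_
  rw [toReal_pmf_map_apply, sum_mul]
  exact sum_congr rfl fun a ha ↦ by rw [(mem_filter.1 ha).2]

end FinitePMF

lemma pmf_map_apply_of_injective {A B : Type*} (p : PMF A) {f : A → B} (hf : Function.Injective f)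
    (a : A) : p.map f (f a) = p a := by
  classical
  simp [PMF.map_apply, hf.eq_iff]

section Typicality

variable {α : Type*}

/-- The probability of the word `y` when its letters are independent with law `p`. -/
noncomputable def iidMass (p : PMF α) {n : ℕ} (y : Fin n → α) : ℝ := ∏ k, (p (y k)).toReal

lemma iidMass_nonneg (p : PMF α) {n : ℕ} (y : Fin n → α) : 0 ≤ iidMass p y :=
  prod_nonneg fun _ _ ↦ ENNReal.toReal_nonneg

lemma logb_iidMass {p : PMF α} {n : ℕ} {y : Fin n → α} (hy : 0 < iidMass p y) :
    Real.logb 2 (iidMass p y) = ∑ k, Real.logb 2 (p (y k)).toReal :=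
  Real.logb_prod _ _ (prod_ne_zero_iff.1 hy.ne')

variable [Fintype α]

lemma exists_pos_sum_mul_exp_lt_one {p f : α → ℝ} {c : ℝ} (hp : ∑ a, p a = 1)
    (hc : ∑ a, p a * f a < c) : ∃ s > 0, ∑ a, p a * Real.exp (s * (f a - c)) < 1 := by
  have hderiv : HasDerivAt (fun s : ℝ ↦ ∑ a, p a * Real.exp (s * (f a - c)))
      (∑ a, p a * (f a - c)) 0 := by
    refine HasDerivAt.fun_sum fun a _ ↦ ?_
    have hlin : HasDerivAt (fun s : ℝ ↦ s * (f a - c)) (f a - c) 0 := by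
      simpa using (hasDerivAt_id (0 : ℝ)).mul_const (f a - c)
    simpa using hlin.exp.const_mul (p a)
  have hneg : ∑ a, p a * (f a - c) < 0 := by
    simp only [mul_sub, sum_sub_distrib, ← sum_mul, hp]
    linarith
  have hslope := (hasDerivAt_iff_tendsto_slope.1 hderiv).mono_left
    (nhdsWithin_mono (0 : ℝ) fun x (hx : x ∈ Set.Ioi 0) ↦ (ne_of_gt hx : x ≠ 0))
  obtain ⟨s, hs, hs0 : 0 < s⟩ :=
    ((hslope.eventually (gt_mem_nhds hneg)).and self_mem_nhdsWithin).exists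
  refine ⟨s, hs0, ?_⟩
  rw [slope_def_field, div_lt_iff₀ (by simpa using hs0)] at hs
  simp only [zero_mul, Real.exp_zero, mul_one, hp] at hs
  linarith

-- Chernoff's bound: the indicator of `n * c ≤ ∑ f` is at most `exp (s * (∑ f - n * c))`, whose mean
-- is the `n`-th power of a number smaller than `1`.
lemma tendsto_sum_prod_of_mean_lt {p f : α → ℝ} {c : ℝ} (hp0 : 0 ≤ p) (hp : ∑ a, p a = 1)
    (hc : ∑ a, p a * f a < c) :
    Tendsto (fun n : ℕ ↦ ∑ y : Fin n → α with n * c ≤ ∑ k, f (y k), ∏ k, p (y k)) atTop (𝓝 0) := by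
  obtain ⟨s, hs, hlt⟩ := exists_pos_sum_mul_exp_lt_one hp hc
  have hprod {n : ℕ} (y : Fin n → α) : 0 ≤ ∏ k, p (y k) := prod_nonneg fun k _ ↦ hp0 _
  refine squeeze_zero (fun n ↦ sum_nonneg fun y _ ↦ hprod y) (fun n ↦ ?_)
    (tendsto_pow_atTop_nhds_zero_of_lt_one
      (sum_nonneg fun a _ ↦ mul_nonneg (hp0 a) (Real.exp_pos (s * (f a - c))).le) hlt)
  rw [Fintype.sum_pow, sum_filter]
  refine sum_le_sum fun y _ ↦ ?_
  rw [prod_mul_distrib, ← Real.exp_sum]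
  split_ifs with hy
  · refine le_mul_of_one_le_right (hprod y) (Real.one_le_exp ?_)
    rw [← mul_sum, sum_sub_distrib]
    exact mul_nonneg hs.le (by simpa using hy)
  · exact mul_nonneg (hprod y) (Real.exp_pos _).le

lemma sum_iidMass (p : PMF α) (n : ℕ) : ∑ y : Fin n → α, iidMass p y = 1 :=
  (Fintype.sum_pow (fun a ↦ (p a).toReal) n).symm.trans (by rw [sum_toReal_pmf_eq_one, one_pow])

lemma sum_filter_le_sum_filter_of_pos_imp {q : α → ℝ} (hq : 0 ≤ q) {P Q : α → Prop}
    [DecidablePred P] [DecidablePred Q] (h : ∀ a, 0 < q a → P a → Q a) :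
    ∑ a with P a, q a ≤ ∑ a with Q a, q a := by
  rw [sum_filter, sum_filter]
  refine sum_le_sum fun a _ ↦ ?_
  rcases (hq a).eq_or_lt with h0 | hpos
  · simp [← h0]
  · by_cases hP : P a
    · simp [hP, h a hpos hP]
    · simpa only [hP, if_false] using ite_nonneg (hq a) le_rfl

lemma tendsto_sum_iidMass_gt_rpow {p : PMF α} {c : ℝ} (hc : c < shannonEntropy p) :
    Tendsto (fun n : ℕ ↦ ∑ y : Fin n → α with (2 : ℝ) ^ (-(n * c)) < iidMass p y, iidMass p y)
      atTop (𝓝 0) := by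
  have hmean : ∑ a, (p a).toReal * Real.logb 2 (p a).toReal < -c := by
    simp only [shannonEntropy, sum_neg_distrib] at hc
    linarith
  refine squeeze_zero (fun n ↦ sum_nonneg fun y _ ↦ iidMass_nonneg p y) (fun n ↦ ?_)
    (tendsto_sum_prod_of_mean_lt (fun _ ↦ ENNReal.toReal_nonneg) (sum_toReal_pmf_eq_one p) hmean)
  refine sum_filter_le_sum_filter_of_pos_imp (iidMass_nonneg p) fun y hpos hy ↦ ?_
  rw [← logb_iidMass hpos, mul_neg]
  exact (Real.le_logb_iff_rpow_le one_lt_two hpos).2 hy.le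

lemma tendsto_sum_iidMass_le_rpow {p : PMF α} {c : ℝ} (hc : shannonEntropy p < c) :
    Tendsto (fun n : ℕ ↦ ∑ y : Fin n → α with iidMass p y ≤ (2 : ℝ) ^ (-(n * c)), iidMass p y)
      atTop (𝓝 0) := by
  have hmean : ∑ a, (p a).toReal * -Real.logb 2 (p a).toReal < c := by
    simpa only [shannonEntropy, mul_neg] using hc
  refine squeeze_zero (fun n ↦ sum_nonneg fun y _ ↦ iidMass_nonneg p y) (fun n ↦ ?_)
    (tendsto_sum_prod_of_mean_lt (fun _ ↦ ENNReal.toReal_nonneg) (sum_toReal_pmf_eq_one p) hmean)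
  refine sum_filter_le_sum_filter_of_pos_imp (iidMass_nonneg p) fun y hpos hy ↦ ?_
  rw [sum_neg_distrib, ← logb_iidMass hpos, le_neg]
  exact (Real.logb_le_iff_le_rpow one_lt_two hpos).2 hy

lemma card_filter_lt_le_inv {q : α → ℝ} (hq0 : 0 ≤ q) (hq : ∑ a, q a = 1) {θ : ℝ} (hθ : 0 < θ) :
    (#{a | θ < q a} : ℝ) ≤ θ⁻¹ := by
  rw [← one_div, le_div_iff₀ hθ, ← nsmul_eq_mul, ← hq]
  exact (card_nsmul_le_sum _ _ _ fun a ha ↦ (mem_filter.1 ha).2.le).trans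
    (sum_le_univ_sum_of_nonneg hq0)

end Typicality

section Quantization

variable {A B : Type*} [Fintype A] [DecidableEq A]

-- Greedily, `b` is given to an element of `A` whose deficit still exceeds `η`.
lemma exists_map_le_sum_fiber_add [Nonempty A] {p : B → ℝ} {η : ℝ} (hη : 0 ≤ η)
    (hp0 : 0 ≤ p) (hpη : ∀ b, p b ≤ η) (s : Finset B) {q : A → ℝ} (hq0 : 0 ≤ q)
    (hq : ∑ a, q a ≤ ∑ b ∈ s, p b) :
    ∃ g : B → A, ∀ a, q a ≤ ∑ b ∈ s with g b = a, p b + η := by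
  classical
  induction s using Finset.induction_on generalizing q with
  | empty =>
    inhabit A
    refine ⟨fun _ ↦ default, fun a ↦ ?_⟩
    simpa using (single_le_sum (fun a _ ↦ hq0 a) (mem_univ a)).trans (hq.trans (by simpa using hη))
  | insert b s hb ih =>
    by_cases hsmall : ∀ a, q a ≤ η
    · inhabit A
      exact ⟨fun _ ↦ default, fun a ↦ (hsmall a).trans
        (le_add_of_nonneg_left (sum_nonneg fun b _ ↦ hp0 b))⟩
    push Not at hsmall
    obtain ⟨a₀, ha₀⟩ := hsmall
    obtain ⟨g, hg⟩ := ih (q := Function.update q a₀ (q a₀ - p b))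
      (fun a ↦ by
        rcases eq_or_ne a a₀ with rfl | ha
        · simpa using (hpη b).trans ha₀.le
        · simpa [ha] using hq0 a)
      (by
        rw [sum_insert hb] at hq
        have := add_sum_erase univ q (mem_univ a₀)
        rw [sum_update_of_mem (mem_univ a₀), sdiff_singleton_eq_erase]
        linarith)
    refine ⟨Function.update g b a₀, fun a ↦ ?_⟩
    have hfiber :
        ∑ b' ∈ s with Function.update g b a₀ b' = a, p b' = ∑ b' ∈ s with g b' = a, p b' :=
      sum_congr (filter_congr fun b' hb' ↦ by
        rw [Function.update_of_ne (ne_of_mem_of_not_mem hb' hb)]) fun _ _ ↦ rfl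
    have hga := hg a
    rw [filter_insert, Function.update_self]
    rcases eq_or_ne a₀ a with rfl | ha
    · rw [if_pos rfl, sum_insert fun h ↦ hb (mem_filter.1 h).1, hfiber]
      rw [Function.update_self] at hga
      linarith
    · rwa [if_neg ha, hfiber, ← Function.update_of_ne ha.symm (q a₀ - p b) q]

lemma sum_abs_sub_le_of_le_add {P q : A → ℝ} (hP0 : 0 ≤ P) (hq0 : 0 ≤ q)
    (hsum : ∑ a, P a = ∑ a, q a) {η : ℝ} (hη : 0 ≤ η) (h : ∀ a, q a ≤ P a + η) (T : Finset A) :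
    ∑ a, |P a - q a| ≤ 2 * (#T * η + ∑ a ∈ Tᶜ, q a) := by
  have habs (a : A) : |P a - q a| = P a - q a + 2 * max (q a - P a) 0 := by
    rcases le_total (P a) (q a) with hle | hle
    · rw [abs_of_nonpos (by linarith), max_eq_left (by linarith)]; ring
    · rw [abs_of_nonneg (by linarith), max_eq_right (by linarith)]; ring
  have hT : ∑ a ∈ T, max (q a - P a) 0 ≤ #T * η := by
    rw [← nsmul_eq_mul]
    exact sum_le_card_nsmul _ _ _ fun a _ ↦ max_le (by linarith [h a]) hη
  have hTc : ∑ a ∈ Tᶜ, max (q a - P a) 0 ≤ ∑ a ∈ Tᶜ, q a :=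
    sum_le_sum fun a _ ↦ max_le (by linarith [show 0 ≤ P a from hP0 a]) (hq0 a)
  simp only [habs, sum_add_distrib, sum_sub_distrib, hsum, sub_self, zero_add, ← mul_sum]
  rw [← sum_add_sum_compl T]
  linarith

end Quantization

section Finner

variable {ι κ : Type*} [DecidableEq ι] {X : ι → Type*}

lemma update_eq_of_dependsOn {β : Type*} {f : (∀ i, X i) → β} {J : Finset ι} (hf : DependsOn f J)
    {j : ι} (hj : j ∉ J) (x : ∀ i, X i) (a : X j) : f (Function.update x j a) = f x :=
  hf fun _ hi ↦ Function.update_of_ne (ne_of_mem_of_not_mem (mem_coe.1 hi) hj) _ _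

variable [∀ i, MeasurableSpace (X i)] {μ : ∀ i, Measure (X i)}

lemma dependsOn_lmarginal {f : (∀ i, X i) → ℝ≥0∞} {J : Set ι} (hf : DependsOn f J) (s : Finset ι) :
    DependsOn (∫⋯∫⁻_s, f ∂μ) J := fun x y hxy ↦ by
  refine lintegral_congr fun z ↦ hf fun i hi ↦ ?_
  by_cases his : i ∈ s
  · simp [Function.updateFinset, his]
  · simpa [Function.updateFinset, his] using hxy i hi

variable [∀ i, IsProbabilityMeasure (μ i)]

lemma lmarginal_singleton_of_dependsOn {f : (∀ i, X i) → ℝ≥0∞} {J : Finset ι} (hf : DependsOn f J)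
    {j : ι} (hj : j ∉ J) : ∫⋯∫⁻_{j}, f ∂μ = f := by
  simp [lmarginal_singleton, update_eq_of_dependsOn hf hj]

lemma lmarginal_singleton_prod_rpow_le {K : Finset κ} {f : κ → (∀ i, X i) → ℝ≥0∞}
    (hf : ∀ k ∈ K, Measurable (f k)) {J : κ → Finset ι} (hJ : ∀ k ∈ K, DependsOn (f k) (J k))
    {p : κ → ℝ} (hp0 : ∀ k ∈ K, 0 ≤ p k) {j : ι} (hp : ∑ k ∈ K with j ∈ J k, p k = 1) :
    ∫⋯∫⁻_{j}, (fun x ↦ ∏ k ∈ K, f k x ^ p k) ∂μ ≤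
      fun x ↦ ∏ k ∈ K, (∫⋯∫⁻_{j}, f k ∂μ) x ^ p k := by
  intro x
  have hmeas (k : κ) (hk : k ∈ K) : Measurable fun a ↦ f k (Function.update x j a) :=
    (hf k hk).comp (measurable_update x)
  rw [lmarginal_singleton]
  calc ∫⁻ a, ∏ k ∈ K, f k (Function.update x j a) ^ p k ∂μ j
      = ∫⁻ a, (∏ k ∈ K with j ∈ J k, f k (Function.update x j a) ^ p k) *
          ∏ k ∈ K with j ∉ J k, f k x ^ p k ∂μ j := by
        refine lintegral_congr fun a ↦ ?_
        rw [← prod_filter_mul_prod_filter_not K fun k ↦ j ∈ J k]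
        refine congrArg _ (prod_congr rfl fun k hk ↦ ?_)
        obtain ⟨hk, hjk⟩ := mem_filter.1 hk
        rw [update_eq_of_dependsOn (hJ k hk) hjk]
    _ = (∫⁻ a, ∏ k ∈ K with j ∈ J k, f k (Function.update x j a) ^ p k ∂μ j) *
          ∏ k ∈ K with j ∉ J k, f k x ^ p k :=
        lintegral_mul_const _ (Finset.measurable_fun_prod _ fun k hk ↦
          (hmeas k (mem_filter.1 hk).1).pow_const _)
    _ ≤ (∏ k ∈ K with j ∈ J k, (∫⋯∫⁻_{j}, f k ∂μ) x ^ p k) *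
          ∏ k ∈ K with j ∉ J k, (∫⋯∫⁻_{j}, f k ∂μ) x ^ p k := by
        refine mul_le_mul' ?_ (prod_le_prod' fun k hk ↦ ?_)
        · simp only [lmarginal_singleton]
          exact ENNReal.lintegral_prod_norm_pow_le _
            (fun k hk ↦ (hmeas k (mem_filter.1 hk).1).aemeasurable) hp
            fun k hk ↦ hp0 k (mem_filter.1 hk).1
        · obtain ⟨hk, hjk⟩ := mem_filter.1 hk
          rw [lmarginal_singleton_of_dependsOn (hJ k hk) hjk]
    _ = _ := prod_filter_mul_prod_filter_not K _ _

-- Finner's inequality: Hölder's inequality is applied in one coordinate at a time.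
lemma lmarginal_prod_rpow_le_prod_lmarginal_rpow (s : Finset ι) {K : Finset κ}
    {f : κ → (∀ i, X i) → ℝ≥0∞} (hf : ∀ k ∈ K, Measurable (f k)) {J : κ → Finset ι}
    (hJ : ∀ k ∈ K, DependsOn (f k) (J k)) {p : κ → ℝ} (hp0 : ∀ k ∈ K, 0 ≤ p k)
    (hp : ∀ j ∈ s, ∑ k ∈ K with j ∈ J k, p k = 1) :
    ∫⋯∫⁻_s, (fun x ↦ ∏ k ∈ K, f k x ^ p k) ∂μ ≤
      fun x ↦ ∏ k ∈ K, (∫⋯∫⁻_s, f k ∂μ) x ^ p k := by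
  induction s using Finset.induction_on generalizing f with
  | empty => simp only [lmarginal_empty, le_refl]
  | insert j s hj ih =>
    have hinsert {g : (∀ i, X i) → ℝ≥0∞} (hg : Measurable g) :
        ∫⋯∫⁻_insert j s, g ∂μ = ∫⋯∫⁻_s, ∫⋯∫⁻_{j}, g ∂μ ∂μ := by
      rw [lmarginal_insert' _ hg hj, lmarginal_singleton]
    calc ∫⋯∫⁻_insert j s, (fun x ↦ ∏ k ∈ K, f k x ^ p k) ∂μ
        = ∫⋯∫⁻_s, ∫⋯∫⁻_{j}, (fun x ↦ ∏ k ∈ K, f k x ^ p k) ∂μ ∂μ :=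
          hinsert (Finset.measurable_fun_prod _ fun k hk ↦ (hf k hk).pow_const _)
      _ ≤ ∫⋯∫⁻_s, (fun x ↦ ∏ k ∈ K, (∫⋯∫⁻_{j}, f k ∂μ) x ^ p k) ∂μ :=
          lmarginal_mono (lmarginal_singleton_prod_rpow_le hf hJ hp0 (hp j (mem_insert_self j s)))
      _ ≤ fun x ↦ ∏ k ∈ K, (∫⋯∫⁻_s, ∫⋯∫⁻_{j}, f k ∂μ ∂μ) x ^ p k :=
          ih (fun k hk ↦ (hf k hk).lmarginal μ) (fun k hk ↦ dependsOn_lmarginal (hJ k hk) _)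
            fun i hi ↦ hp i (mem_insert_of_mem hi)
      _ = fun x ↦ ∏ k ∈ K, (∫⋯∫⁻_insert j s, f k ∂μ) x ^ p k :=
          funext fun x ↦ prod_congr rfl fun k hk ↦ by rw [hinsert (hf k hk)]

end Finner

section ListBound

lemma sum_prod_rpow_le_prod_sum_rpow {κ Y : Type*} (G : Finset Y) (K : Finset κ)
    (f : κ → Y → ℝ≥0∞) {p : κ → ℝ} (hp0 : ∀ k ∈ K, 0 ≤ p k) (hp : ∑ k ∈ K, p k = 1) :
    ∑ y ∈ G, ∏ k ∈ K, f k y ^ p k ≤ ∏ k ∈ K, (∑ y ∈ G, f k y) ^ p k := by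
  let _ : MeasurableSpace G := ⊤
  simpa only [lintegral_count, tsum_fintype, sum_coe_sort G fun y ↦ ∏ k ∈ K, f k y ^ p k,
    fun k ↦ sum_coe_sort G (f k)] using ENNReal.lintegral_prod_norm_pow_le (μ := .count) K
      (fun k _ ↦ (Measurable.of_discrete (f := fun y : G ↦ f k y)).aemeasurable) hp hp0

variable {ι Y : Type*}

lemma le_rpow_inv_card_mul_prod_of_ne_zero {U : Finset ι} (hU : U.Nonempty) {a : ℝ≥0∞}
    (ha : a ≤ 1) {b : ι → ℝ≥0∞} (hb : a ≠ 0 → ∀ j ∈ U, 1 ≤ b j) :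
    a ≤ a ^ (#U : ℝ)⁻¹ * ∏ j ∈ U, b j ^ (#U : ℝ)⁻¹ := by
  rcases eq_or_ne a 0 with rfl | ha0
  · exact zero_le
  have hb1 : 1 ≤ ∏ j ∈ U, b j ^ (#U : ℝ)⁻¹ := by
    rw [← prod_const_one (s := U)]
    exact prod_le_prod' fun j hj ↦ ENNReal.one_le_rpow (hb ha0 j hj) (by simpa using hU.card_pos)
  calc a = a ^ (1 : ℝ) := (ENNReal.rpow_one a).symm
    _ ≤ a ^ (#U : ℝ)⁻¹ := ENNReal.rpow_le_rpow_of_exponent_ge ha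
        (inv_le_one_of_one_le₀ (Nat.one_le_cast.2 hU.card_pos))
    _ ≤ _ := le_mul_of_one_le_right' hb1

variable [DecidableEq ι] {X : ι → Type*} [∀ i, MeasurableSpace (X i)] {μ : ∀ i, Measure (X i)}

lemma lmarginal_finset_sum {G : Finset Y} {f : Y → (∀ i, X i) → ℝ≥0∞}
    (hf : ∀ y ∈ G, Measurable (f y)) (U : Finset ι) :
    ∫⋯∫⁻_U, (fun x ↦ ∑ y ∈ G, f y x) ∂μ = fun x ↦ ∑ y ∈ G, (∫⋯∫⁻_U, f y ∂μ) x :=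
  funext fun _ ↦ lintegral_finsetSum _ fun y hy ↦ (hf y hy).comp measurable_updateFinset

lemma le_prod_mul_lmarginal [∀ i, SigmaFinite (μ i)] [∀ i, MeasurableSingletonClass (X i)]
    {f : (∀ i, X i) → ℝ≥0∞} (hf : Measurable f) {N : ι → ℝ≥0∞}
    (hN : ∀ i x, 1 ≤ N i * μ i {x}) (S : Finset ι) (x : ∀ i, X i) :
    f x ≤ (∏ i ∈ S, N i) * (∫⋯∫⁻_S, f ∂μ) x := by
  induction S using Finset.induction_on generalizing x with
  | empty => simp
  | insert j S hj ih =>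
    rw [prod_insert hj, lmarginal_insert _ hf hj, mul_comm (N j), mul_assoc]
    refine (ih x).trans ?_
    gcongr
    calc (∫⋯∫⁻_S, f ∂μ) x ≤ N j * μ j {x j} * (∫⋯∫⁻_S, f ∂μ) x := le_mul_of_one_le_left' (hN j _)
      _ = N j * ∫⁻ a in {x j}, (∫⋯∫⁻_S, f ∂μ) (Function.update x j a) ∂μ j := by
        rw [lintegral_singleton, Function.update_eq_self]; ring
      _ ≤ _ := by gcongr; exact Measure.restrict_le_self

lemma lmarginal_le_prod_compl_mul_lintegral [Fintype ι] [∀ i, SigmaFinite (μ i)]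
    [∀ i, MeasurableSingletonClass (X i)]
    {f : (∀ i, X i) → ℝ≥0∞} (hf : Measurable f) {N : ι → ℝ≥0∞}
    (hN : ∀ i x, 1 ≤ N i * μ i {x}) (U : Finset ι) (x : ∀ i, X i) :
    (∫⋯∫⁻_U, f ∂μ) x ≤ (∏ i ∈ Uᶜ, N i) * ∫⁻ x, f x ∂.pi μ := by
  refine (le_prod_mul_lmarginal (hf.lmarginal μ) hN Uᶜ x).trans_eq ?_
  rw [← lmarginal_union μ f hf disjoint_compl_left, union_comm, union_compl,
    lintegral_eq_lmarginal_univ x]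

variable [∀ i, IsProbabilityMeasure (μ i)]

lemma lmarginal_const (U : Finset ι) (a : ℝ≥0∞) : ∫⋯∫⁻_U, (fun _ ↦ a) ∂μ = fun _ ↦ a := by
  ext
  simp [lmarginal]

variable [Fintype ι]

lemma lmarginal_le_rpow_inv_card_mul_prod {U : Finset ι} (hU : U.Nonempty)
    {f : (∀ i, X i) → ℝ≥0∞} (hf : Measurable f) (hf1 : f ≤ 1)
    {c : ι → (∀ i, X i) → ℝ≥0∞} (hc : ∀ j ∈ U, Measurable (c j))
    (hcJ : ∀ j ∈ U, DependsOn (c j) ({j}ᶜ : Finset ι)) (hfc : ∀ x, f x ≠ 0 → ∀ j ∈ U, 1 ≤ c j x)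
    (x : ∀ i, X i) :
    (∫⋯∫⁻_U, f ∂μ) x ≤
      (∫⋯∫⁻_U, f ∂μ) x ^ (#U : ℝ)⁻¹ * ∏ j ∈ U, (∫⋯∫⁻_U, c j ∂μ) x ^ (#U : ℝ)⁻¹ := by
  -- Finner's inequality with weight `1 / #U` for `f` and for each `c j`: a coordinate in `U` is
  -- missing from exactly one of these `#U + 1` functions.
  let J (k : Option ι) : Finset ι := k.elim univ fun j ↦ {j}ᶜ
  have hweights (j : ι) (hj : j ∈ U) : ∑ k ∈ insertNone U with j ∈ J k, (#U : ℝ)⁻¹ = 1 := by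
    have hJ : #{k ∈ insertNone U | j ∈ J k} = #U := by
      rw [show ({k ∈ insertNone U | j ∈ J k} : Finset (Option ι)) = insertNone (U.erase j) by
        ext (_ | k) <;> simp [J, and_comm, eq_comm], card_insertNone, card_erase_add_one hj]
    rw [sum_const, hJ, nsmul_eq_mul, mul_inv_cancel₀ (by simpa using hU.ne_empty)]
  have hfinner := lmarginal_prod_rpow_le_prod_lmarginal_rpow (μ := μ) U (K := insertNone U)
    (f := fun k ↦ k.elim f c) (J := J) (forall_mem_insertNone.2 ⟨hf, hc⟩)
    (forall_mem_insertNone.2 ⟨by simp [J, dependsOn_univ], hcJ⟩) (p := fun _ ↦ (#U : ℝ)⁻¹)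
    (fun _ _ ↦ by positivity) hweights x
  simp only [prod_insertNone] at hfinner
  exact (lmarginal_mono (fun y ↦ le_rpow_inv_card_mul_prod_of_ne_zero hU (hf1 y) (hfc y)) x).trans
    hfinner

lemma sum_lintegral_le_rpow_inv_card_mul {U : Finset ι} (hU : U.Nonempty) {G : Finset Y}
    {f : Y → (∀ i, X i) → ℝ≥0∞} (hf : ∀ y, Measurable (f y)) (hf1 : ∀ y, f y ≤ 1)
    {c : ι → Y → (∀ i, X i) → ℝ≥0∞} (hc : ∀ j y, Measurable (c j y))
    (hcJ : ∀ j y, DependsOn (c j y) ({j}ᶜ : Finset ι)) (hfc : ∀ y x, f y x ≠ 0 → ∀ j, 1 ≤ c j y x)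
    {B : ℝ≥0∞} (hB : ∀ y ∈ G, ∀ x, (∫⋯∫⁻_U, f y ∂μ) x ≤ B)
    {L : ℝ≥0∞} (hL : ∀ j x, ∑ y ∈ G, c j y x ≤ L) :
    ∑ y ∈ G, ∫⁻ x, f y x ∂.pi μ ≤ B ^ (#U : ℝ)⁻¹ * L := by
  have hu : (#U : ℝ) ≠ 0 := by simpa using hU.ne_empty
  have hpoint (x : ∀ i, X i) : ∑ y ∈ G, (∫⋯∫⁻_U, f y ∂μ) x ≤ B ^ (#U : ℝ)⁻¹ * L :=
    calc ∑ y ∈ G, (∫⋯∫⁻_U, f y ∂μ) x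
        ≤ ∑ y ∈ G, B ^ (#U : ℝ)⁻¹ * ∏ j ∈ U, (∫⋯∫⁻_U, c j y ∂μ) x ^ (#U : ℝ)⁻¹ := by
          refine sum_le_sum fun y hy ↦ (lmarginal_le_rpow_inv_card_mul_prod hU (hf y) (hf1 y)
            (fun j _ ↦ hc j y) (fun j _ ↦ hcJ j y) (fun x hx j _ ↦ hfc y x hx j) x).trans ?_
          gcongr
          exact hB y hy x
      _ ≤ B ^ (#U : ℝ)⁻¹ * ∏ j ∈ U, (∑ y ∈ G, (∫⋯∫⁻_U, c j y ∂μ) x) ^ (#U : ℝ)⁻¹ := by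
          rw [← mul_sum]
          gcongr
          exact sum_prod_rpow_le_prod_sum_rpow _ _ _ (fun _ _ ↦ by positivity) (by simp [hu])
      _ ≤ B ^ (#U : ℝ)⁻¹ * ∏ _j ∈ U, L ^ (#U : ℝ)⁻¹ := by
          gcongr with j
          rw [← congrFun (lmarginal_finset_sum (fun y _ ↦ hc j y) U) x,
            ← congrFun (lmarginal_const (μ := μ) U L) x]
          exact lmarginal_mono (hL j) x
      _ = B ^ (#U : ℝ)⁻¹ * L := by
          rw [prod_const, ← ENNReal.rpow_natCast, ENNReal.rpow_inv_rpow hu]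
  rw [← lintegral_finsetSum _ fun y _ ↦ hf y]
  refine (lintegral_le_of_lmarginal_le U (Finset.measurable_fun_sum _ fun y _ ↦ hf y)
    measurable_const (g := fun _ ↦ B ^ (#U : ℝ)⁻¹ * L) fun x ↦ ?_).trans (by simp)
  rw [lmarginal_finset_sum (fun y _ ↦ hf y), lmarginal_const]
  exact hpoint x

end ListBound

section Agreement

variable {ι M Y : Type*} [Fintype ι] [Fintype M]

/-- The probability that all the processors output `y`, when the message has law `enc` and the
processor `i` decodes the message `m` into a random output of law `dec i m`. -/
noncomputable def agreementMass (enc : PMF M) (dec : ι → M → PMF Y) (y : Y) : ℝ≥0∞ :=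
  ∑ m, enc m * ∏ i, dec i m y

/-- The contribution to `agreementMass` of the messages that every processor decodes into `y` with
probability larger than `1 / 2`. -/
noncomputable def decisiveMass (enc : PMF M) (dec : ι → M → PMF Y) (y : Y) : ℝ≥0∞ :=
  ∑ m with ∀ i, 1 / 2 < dec i m y, enc m * ∏ i, dec i m y

/-- The number of messages that are decoded into `y` with probability larger than `1 / 2`, by a
processor that decodes the message `m` into a random output of law `dec m`. -/
noncomputable def listSize (dec : M → PMF Y) (y : Y) : ℕ := #{m | 1 / 2 < dec m y}

variable {enc : PMF M} {dec : ι → M → PMF Y}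

lemma decisiveMass_le_agreementMass (y : Y) : decisiveMass enc dec y ≤ agreementMass enc dec y :=
  sum_le_sum_of_subset (filter_subset _ _)

lemma agreementMass_le_one (y : Y) : agreementMass enc dec y ≤ 1 := by
  rw [← sum_pmf_eq_one enc]
  exact sum_le_sum fun m _ ↦ mul_le_of_le_one_right' (prod_le_one' fun i _ ↦ (dec i m).coe_le_one y)

lemma one_le_listSize_of_decisiveMass_ne_zero {y : Y} (hy : decisiveMass enc dec y ≠ 0) (i : ι) :
    1 ≤ listSize (dec i) y := by
  obtain ⟨m, hm, -⟩ := exists_ne_zero_of_sum_ne_zero hy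
  exact card_pos.2 ⟨m, mem_filter.2 ⟨mem_univ m, (mem_filter.1 hm).2 i⟩⟩

lemma card_filter_half_lt_le_one (p : PMF Y) (G : Finset Y) : #{y ∈ G | 1 / 2 < p y} ≤ 1 := by
  classical
  refine card_le_one.2 fun y hy z hz ↦ by_contra fun hyz ↦ ?_
  have hsum : p y + p z ≤ 1 := by
    rw [← sum_pair hyz, ← p.tsum_coe]
    exact ENNReal.sum_le_tsum _
  refine hsum.not_gt ?_
  rw [← ENNReal.add_halves 1]
  exact ENNReal.add_lt_add (mem_filter.1 hy).2 (mem_filter.1 hz).2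

lemma sum_listSize_le_card (dec : M → PMF Y) (G : Finset Y) :
    ∑ y ∈ G, listSize dec y ≤ Fintype.card M := by
  calc ∑ y ∈ G, listSize dec y = ∑ m, #{y ∈ G | 1 / 2 < dec m y} :=
        (sum_card_bipartiteAbove_eq_sum_card_bipartiteBelow fun m y ↦ 1 / 2 < dec m y).symm
    _ ≤ _ := by
      simpa using sum_le_card_nsmul univ _ 1 fun m _ ↦ card_filter_half_lt_le_one (dec m) G

-- A factor that is at most `1 / 2` makes the product at most half of each of the other factors.
lemma ite_prod_add_card_mul_prod_le_sum [Nontrivial ι] {d : ι → ℝ≥0∞} (hd : ∀ i, d i ≤ 1) :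
    (if ∀ i, 1 / 2 < d i then 0 else ∏ i, d i) + Fintype.card ι * ∏ i, d i ≤ ∑ i, d i := by
  classical
  have hle (i : ι) : ∏ k, d k ≤ d i := by
    rw [← mul_prod_erase univ d (mem_univ i)]
    exact mul_le_of_le_one_right' (prod_le_one' fun k _ ↦ hd k)
  rw [← nsmul_eq_mul, ← card_univ, ← sum_const]
  split_ifs with h
  · rw [zero_add]
    exact sum_le_sum fun i _ ↦ hle i
  push Not at h
  obtain ⟨i, hi⟩ := h
  obtain ⟨k, hki⟩ := exists_ne i
  have hk : ∏ l, d l + ∏ l, d l ≤ d k := by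
    have : ∏ l, d l ≤ d k / 2 := by
      rw [← mul_prod_erase univ d (mem_univ k), div_eq_mul_one_div]
      gcongr
      rw [← mul_prod_erase _ d (mem_erase.2 ⟨hki.symm, mem_univ i⟩)]
      exact (mul_le_of_le_one_right' (prod_le_one' fun l _ ↦ hd l)).trans hi
    exact (add_le_add this this).trans_eq (ENNReal.add_halves _)
  rw [← add_sum_erase _ _ (mem_univ k), ← add_sum_erase _ d (mem_univ k), ← add_assoc]
  exact add_le_add hk (sum_le_sum fun l _ ↦ hle l)

lemma sum_agreementMass_add_le [Fintype Y] [Nontrivial ι] (enc : PMF M) (dec : ι → M → PMF Y)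
    (G : Finset Y) :
    ∑ y ∈ G, agreementMass enc dec y + Fintype.card ι * ∑ y, agreementMass enc dec y ≤
      ∑ y ∈ G, decisiveMass enc dec y + Fintype.card ι := by
  let rest (m : M) (y : Y) : ℝ≥0∞ := if ∀ i, 1 / 2 < dec i m y then 0 else ∏ i, dec i m y
  have hsplit (y : Y) :
      agreementMass enc dec y = decisiveMass enc dec y + ∑ m, enc m * rest m y := by
    rw [agreementMass, decisiveMass, sum_filter, ← sum_add_distrib]
    refine sum_congr rfl fun m _ ↦ ?_
    simp only [rest]
    split_ifs <;> simp
  have hrest : ∑ y, (∑ m, enc m * rest m y + Fintype.card ι * agreementMass enc dec y) ≤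
      Fintype.card ι :=
    calc ∑ y, (∑ m, enc m * rest m y + Fintype.card ι * agreementMass enc dec y)
        = ∑ y, ∑ m, enc m * (rest m y + Fintype.card ι * ∏ i, dec i m y) := by
          simp only [agreementMass, mul_sum, ← sum_add_distrib, mul_add, mul_left_comm]
      _ ≤ ∑ y, ∑ m, enc m * ∑ i, dec i m y := by
          gcongr with y _ m
          exact ite_prod_add_card_mul_prod_le_sum fun i ↦ (dec i m).coe_le_one y
      _ = ∑ m, enc m * ∑ i, ∑ y, dec i m y := by
          rw [sum_comm]
          exact sum_congr rfl fun m _ ↦ by rw [← mul_sum, sum_comm]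
      _ = Fintype.card ι := by simp [sum_pmf_eq_one, ← sum_mul]
  calc ∑ y ∈ G, agreementMass enc dec y + Fintype.card ι * ∑ y, agreementMass enc dec y
      = ∑ y ∈ G, decisiveMass enc dec y + (∑ y ∈ G, ∑ m, enc m * rest m y +
          ∑ y, Fintype.card ι * agreementMass enc dec y) := by
        rw [← add_assoc, ← sum_add_distrib, ← mul_sum]
        simp only [← hsplit]
    _ ≤ ∑ y ∈ G, decisiveMass enc dec y + Fintype.card ι := by
        refine add_le_add_right (le_trans ?_ hrest) _
        rw [sum_add_distrib]
        exact add_le_add_left (sum_le_sum_of_subset (subset_univ G)) _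

end Agreement

section ForeheadListBound

variable {ι M Y : Type*} [Fintype ι] [DecidableEq ι] [Nontrivial ι] [Fintype M] [Fintype Y]
  {X : ι → Type*} [∀ i, MeasurableSpace (X i)] [DiscreteMeasurableSpace (∀ i, X i)]
  [∀ i, MeasurableSingletonClass (X i)]
  {μ : ∀ i, Measure (X i)} [∀ i, IsProbabilityMeasure (μ i)]

lemma sum_lintegral_agreementMass_add_le {U : Finset ι} (hU : U.Nonempty)
    (enc : (∀ i, X i) → PMF M) (dec : ι → M → (∀ i, X i) → PMF Y)
    (hdec : ∀ i m, DependsOn (dec i m) ({i}ᶜ : Finset ι)) {N : ι → ℝ≥0∞}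
    (hN : ∀ i x, 1 ≤ N i * μ i {x}) {G : Finset Y} {K : ℝ≥0∞}
    (hK : ∀ y ∈ G, ∫⁻ w, agreementMass (enc w) (fun i m ↦ dec i m w) y ∂.pi μ ≤ K) :
    ∑ y ∈ G, ∫⁻ w, agreementMass (enc w) (fun i m ↦ dec i m w) y ∂.pi μ +
        Fintype.card ι * ∑ y, ∫⁻ w, agreementMass (enc w) (fun i m ↦ dec i m w) y ∂.pi μ ≤
      ((∏ i ∈ Uᶜ, N i) * K) ^ (#U : ℝ)⁻¹ * Fintype.card M + Fintype.card ι := by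
  have hlist : ∑ y ∈ G, ∫⁻ w, decisiveMass (enc w) (fun i m ↦ dec i m w) y ∂.pi μ ≤
      ((∏ i ∈ Uᶜ, N i) * K) ^ (#U : ℝ)⁻¹ * Fintype.card M := by
    refine sum_lintegral_le_rpow_inv_card_mul hU (fun _ ↦ .of_discrete)
      (fun y w ↦ (decisiveMass_le_agreementMass y).trans (agreementMass_le_one y))
      (c := fun i y w ↦ (listSize (fun m ↦ dec i m w) y : ℝ≥0∞)) (fun _ _ ↦ .of_discrete)
      (fun i y v w hvw ↦ by simp only [listSize, hdec i _ hvw])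
      (fun y w hw i ↦ by exact_mod_cast one_le_listSize_of_decisiveMass_ne_zero hw i)
      (fun y hy w ↦ ?_) fun i w ↦ by exact_mod_cast sum_listSize_le_card (fun m ↦ dec i m w) G
    refine (lmarginal_le_prod_compl_mul_lintegral .of_discrete hN U w).trans ?_
    gcongr
    exact (lintegral_mono fun w ↦ decisiveMass_le_agreementMass y).trans (hK y hy)
  refine le_trans ?_ (add_le_add_left hlist _)
  calc ∑ y ∈ G, ∫⁻ w, agreementMass (enc w) (fun i m ↦ dec i m w) y ∂.pi μ +
        Fintype.card ι * ∑ y, ∫⁻ w, agreementMass (enc w) (fun i m ↦ dec i m w) y ∂.pi μ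
      = ∫⁻ w, (∑ y ∈ G, agreementMass (enc w) (fun i m ↦ dec i m w) y +
          Fintype.card ι * ∑ y, agreementMass (enc w) (fun i m ↦ dec i m w) y) ∂.pi μ := by
        rw [lintegral_add_left .of_discrete, lintegral_const_mul _ .of_discrete,
          lintegral_finsetSum _ fun _ _ ↦ .of_discrete,
          lintegral_finsetSum _ fun _ _ ↦ .of_discrete]
    _ ≤ ∫⁻ w, (∑ y ∈ G, decisiveMass (enc w) (fun i m ↦ dec i m w) y + Fintype.card ι) ∂.pi μ :=
        lintegral_mono fun w ↦ sum_agreementMass_add_le _ _ G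
    _ = ∑ y ∈ G, ∫⁻ w, decisiveMass (enc w) (fun i m ↦ dec i m w) y ∂.pi μ + Fintype.card ι := by
        rw [lintegral_add_left .of_discrete, lintegral_finsetSum _ fun _ _ ↦ .of_discrete]
        simp

end ForeheadListBound

section IndexCount

lemma indexCount_pos (n : ℕ) {r : ℝ} (hr : 0 ≤ r) : 0 < indexCount n r :=
  Nat.floor_pos.2 (Real.one_le_rpow one_le_two (by positivity))

lemma indexCount_le_rpow (n : ℕ) (r : ℝ) : (indexCount n r : ℝ) ≤ 2 ^ (n * r) :=
  Nat.floor_le (by positivity)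

lemma inv_indexCount_le (n : ℕ) {r : ℝ} (hr : 0 ≤ r) :
    (indexCount n r : ℝ)⁻¹ ≤ 2 * 2 ^ (-(n * r)) := by
  have hone : (1 : ℝ) ≤ indexCount n r := Nat.one_le_cast.2 (indexCount_pos n hr)
  have hlt : (2 : ℝ) ^ (n * r) < indexCount n r + 1 := Nat.lt_floor_add_one _
  rw [Real.rpow_neg two_pos.le, inv_le_iff_one_le_mul₀ (by linarith), mul_right_comm,
    ← div_eq_mul_inv, one_le_div (by positivity)]
  linarith

lemma indexCount_mono (n : ℕ) : Monotone (indexCount n) := fun _ _ h ↦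
  Nat.floor_le_floor (Real.rpow_le_rpow_of_exponent_le one_le_two (by gcongr))

end IndexCount

section DiagonalTarget

variable {t : ℕ} {α : Type*}

lemma iidTarget_const [NeZero t] (p : PMF α) (n : ℕ) (y : Fin n → α) :
    iidTarget (p.map (Function.const (Fin t))) n (Function.const (Fin t) y) = iidMass p y :=
  prod_congr rfl fun k _ ↦
    congrArg ENNReal.toReal (pmf_map_apply_of_injective p Function.const_injective (y k))

lemma iidTarget_eq_zero_of_notMem_range {p : PMF α} {n : ℕ} {x : Fin t → Fin n → α}
    (hx : x ∉ Set.range (Function.const (Fin t))) :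
    iidTarget (p.map (Function.const (Fin t))) n x = 0 := by
  by_contra h
  have hcol (k : Fin n) : ∃ a, Function.const (Fin t) a = fun i ↦ x i k := by
    have hk : (fun i ↦ x i k) ∈ (p.map (Function.const (Fin t))).support := fun h0 ↦
      prod_ne_zero_iff.1 h k (mem_univ k) (by rw [h0, ENNReal.toReal_zero])
    obtain ⟨a, -, ha⟩ := (PMF.mem_support_map_iff _ _ _).1 hk
    exact ⟨a, ha⟩
  choose y hy using hcol
  exact hx ⟨y, funext fun i ↦ funext fun k ↦ congrFun (hy k) i⟩

end DiagonalTarget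

section CodeError

/-- The `ℓ¹` distance between the law of the outputs of a simulation code and the i.i.d. law that it
simulates. -/
noncomputable def SimulationCode.error {t h : ℕ} {V : Fin t → Finset (Fin h)} {𝒳 : Fin t → Type*}
    [∀ i, Fintype (𝒳 i)] {n : ℕ} {R : ℝ} {Rs : Fin h → ℝ} (c : SimulationCode V 𝒳 n R Rs)
    (q : PMF (∀ i, 𝒳 i)) : ℝ :=
  ∑ x, |c.induced x - iidTarget q n x|

section Nonneg

variable {t h : ℕ} {V : Fin t → Finset (Fin h)} {𝒳 : Fin t → Type*} {n : ℕ} {R : ℝ}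
  {Rs : Fin h → ℝ} (c : SimulationCode V 𝒳 n R Rs)

lemma SimulationCode.joint_nonneg (w : ∀ j, Fin (indexCount n (Rs j))) (m : Fin (indexCount n R))
    (x : ∀ i, Fin n → 𝒳 i) : 0 ≤ c.joint w m x :=
  mul_nonneg (by positivity) (prod_nonneg fun _ _ ↦ ENNReal.toReal_nonneg)

lemma SimulationCode.induced_nonneg (x : ∀ i, Fin n → 𝒳 i) : 0 ≤ c.induced x :=
  sum_nonneg fun w _ ↦ sum_nonneg fun m _ ↦ c.joint_nonneg w m x

end Nonneg

variable {t : ℕ} [NeZero t] {V : Fin t → Finset (Fin t)} {α : Type*} [Fintype α] {n : ℕ} {R : ℝ}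
  {Rs : Fin t → ℝ} (c : SimulationCode V (fun _ ↦ α) n R Rs) (p : PMF α)

lemma SimulationCode.sum_abs_induced_const_sub_le_error :
    ∑ y : Fin n → α, |c.induced (Function.const (Fin t) y) - iidMass p y| ≤
      c.error (p.map (Function.const (Fin t))) := by
  classical
  simp only [← iidTarget_const (t := t)]
  rw [SimulationCode.error, ← sum_image (g := Function.const (Fin t))
    (f := fun x ↦ |c.induced x - iidTarget (p.map (Function.const (Fin t))) n x|)
    fun y _ z _ h ↦ Function.const_injective h]
  exact sum_le_univ_sum_of_nonneg fun x ↦ abs_nonneg _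

lemma SimulationCode.error_eq_sum_abs_induced_const_sub
    (hc : ∀ x ∉ Set.range (Function.const (Fin t)), c.induced x = 0) :
    c.error (p.map (Function.const (Fin t))) =
      ∑ y : Fin n → α, |c.induced (Function.const (Fin t) y) - iidMass p y| := by
  refine (Fintype.sum_of_injective (Function.const (Fin t)) Function.const_injective _ _
    (fun x hx ↦ ?_) fun y ↦ ?_).symm
  · rw [hc x hx, iidTarget_eq_zero_of_notMem_range hx, sub_zero, abs_zero]
  · rw [iidTarget_const]

end CodeError

section ForeheadConverse

lemma uniformOn_univ_singleton {N : ℕ} (k : Fin N) :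
    uniformOn (Set.univ : Set (Fin N)) {k} = (N : ℝ≥0∞)⁻¹ := by
  rw [uniformOn_univ, Measure.count_singleton, Fintype.card_fin, one_div]

lemma SimulationCode.ofReal_induced {t h : ℕ} {V : Fin t → Finset (Fin h)} {𝒳 : Fin t → Type*}
    {n : ℕ} {R : ℝ} {Rs : Fin h → ℝ} (hRs : ∀ j, 0 ≤ Rs j) (c : SimulationCode V 𝒳 n R Rs)
    (x : ∀ i, Fin n → 𝒳 i) :
    ENNReal.ofReal (c.induced x) =
      ∫⁻ w, ∑ m, c.encoder w m * ∏ i, c.decoder i m (fun j ↦ w j.1) (x i)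
        ∂.pi fun j ↦ uniformOn (Set.univ : Set (Fin (indexCount n (Rs j)))) := by
  have (j : Fin h) : NeZero (indexCount n (Rs j)) := ⟨(indexCount_pos n (hRs j)).ne'⟩
  rw [lintegral_fintype, SimulationCode.induced, ENNReal.ofReal_sum_of_nonneg fun w _ ↦
    sum_nonneg fun m _ ↦ c.joint_nonneg w m x]
  refine sum_congr rfl fun w _ ↦ ?_
  rw [ENNReal.ofReal_sum_of_nonneg fun m _ ↦ c.joint_nonneg w m x, Measure.pi_singleton, sum_mul]
  refine sum_congr rfl fun m _ ↦ ?_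
  simp only [SimulationCode.joint, uniformOn_univ_singleton]
  rw [mul_assoc, ENNReal.ofReal_mul (by positivity), ENNReal.ofReal_mul ENNReal.toReal_nonneg,
    ENNReal.ofReal_prod_of_nonneg fun _ _ ↦ by positivity,
    ENNReal.ofReal_prod_of_nonneg fun _ _ ↦ ENNReal.toReal_nonneg, mul_comm]
  congr 1
  · simp only [ENNReal.ofReal_toReal (PMF.apply_ne_top _ _)]
  · refine prod_congr rfl fun j _ ↦ ?_
    rw [ENNReal.ofReal_inv_of_pos (Nat.cast_pos.2 (indexCount_pos n (hRs j))),
      ENNReal.ofReal_natCast]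

variable {t : ℕ} {α : Type*} [Fintype α] {n : ℕ} {R : ℝ} {Rs : Fin t → ℝ}

lemma SimulationCode.sum_ofReal_induced_const_add_le [Nontrivial (Fin t)] (hRs : ∀ j, 0 ≤ Rs j)
    (c : SimulationCode (foreheadAccess t) (fun _ ↦ α) n R Rs) {S : Finset (Fin t)}
    (hS : S ≠ univ) {G : Finset (Fin n → α)} {K : ℝ≥0∞}
    (hK : ∀ y ∈ G, ENNReal.ofReal (c.induced (Function.const (Fin t) y)) ≤ K) :
    ∑ y ∈ G, ENNReal.ofReal (c.induced (Function.const (Fin t) y)) +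
        t * ∑ y, ENNReal.ofReal (c.induced (Function.const (Fin t) y)) ≤
      ((∏ j ∈ S, (indexCount n (Rs j) : ℝ≥0∞)) * K) ^ (#Sᶜ : ℝ)⁻¹ * indexCount n R + t := by
  have (j : Fin t) : NeZero (indexCount n (Rs j)) := ⟨(indexCount_pos n (hRs j)).ne'⟩
  let dec (i : Fin t) (m : Fin (indexCount n R)) (w : ∀ j, Fin (indexCount n (Rs j))) :
      PMF (Fin n → α) := c.decoder i m fun j ↦ w j.1
  have hdec (i : Fin t) (m : Fin (indexCount n R)) : DependsOn (dec i m) ({i}ᶜ : Finset (Fin t)) :=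
    fun w w' h ↦ congrArg (c.decoder i m) <| funext fun j ↦
      h j.1 (by simpa [foreheadAccess] using j.2)
  have hlintegral (y : Fin n → α) :
      ENNReal.ofReal (c.induced (Function.const (Fin t) y)) =
        ∫⁻ w, agreementMass (c.encoder w) (fun i m ↦ dec i m w) y
          ∂.pi (fun j ↦ uniformOn (Set.univ : Set (Fin (indexCount n (Rs j))))) :=
    c.ofReal_induced hRs _
  have hmass (j : Fin t) (k : Fin (indexCount n (Rs j))) :
      1 ≤ (indexCount n (Rs j) : ℝ≥0∞) * uniformOn (Set.univ : Set (Fin _)) {k} := by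
    rw [uniformOn_univ_singleton, ENNReal.mul_inv_cancel (NeZero.ne _) (ENNReal.natCast_ne_top _)]
  simp only [hlintegral] at hK ⊢
  simpa using sum_lintegral_agreementMass_add_le (U := Sᶜ)
    (by simpa [nonempty_iff_ne_empty] using hS) c.encoder dec hdec hmass hK

lemma SimulationCode.sum_induced_const_add_le [Nontrivial (Fin t)] (hRs : ∀ j, 0 ≤ Rs j)
    (c : SimulationCode (foreheadAccess t) (fun _ ↦ α) n R Rs) {S : Finset (Fin t)}
    (hS : S ≠ univ) {G : Finset (Fin n → α)} {K : ℝ} (hK0 : 0 ≤ K)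
    (hK : ∀ y ∈ G, c.induced (Function.const (Fin t) y) ≤ K) :
    ∑ y ∈ G, c.induced (Function.const (Fin t) y) +
        t * ∑ y, c.induced (Function.const (Fin t) y) ≤
      ((∏ j ∈ S, (indexCount n (Rs j) : ℝ)) * K) ^ (#Sᶜ : ℝ)⁻¹ * indexCount n R + t := by
  have hnonneg (y : Fin n → α) : 0 ≤ c.induced (Function.const (Fin t) y) := c.induced_nonneg _
  have hsum (T : Finset (Fin n → α)) : 0 ≤ ∑ y ∈ T, c.induced (Function.const (Fin t) y) :=
    sum_nonneg fun y _ ↦ hnonneg y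
  have key := c.sum_ofReal_induced_const_add_le hRs hS fun y hy ↦ ENNReal.ofReal_le_ofReal (hK y hy)
  rw [← ENNReal.ofReal_le_ofReal_iff (by positivity)]
  convert key using 1
  · rw [ENNReal.ofReal_add (hsum G) (mul_nonneg (Nat.cast_nonneg _) (hsum univ)),
      ENNReal.ofReal_mul (Nat.cast_nonneg _), ENNReal.ofReal_natCast,
      ENNReal.ofReal_sum_of_nonneg fun y _ ↦ hnonneg y,
      ENNReal.ofReal_sum_of_nonneg fun y _ ↦ hnonneg y]
  · rw [ENNReal.ofReal_add (by positivity) (Nat.cast_nonneg _), ENNReal.ofReal_natCast,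
      ENNReal.ofReal_mul (by positivity), ENNReal.ofReal_natCast,
      ← ENNReal.ofReal_rpow_of_nonneg (by positivity) (by positivity),
      ENNReal.ofReal_mul (by positivity), ENNReal.ofReal_prod_of_nonneg fun _ _ ↦ Nat.cast_nonneg _]
    simp only [ENNReal.ofReal_natCast]

lemma sum_filter_two_mul_lt_le {A : Type*} [Fintype A] {P Q : A → ℝ} (hQ : 0 ≤ Q) (κ : ℝ) :
    ∑ a with 2 * κ < P a, P a ≤ ∑ a with κ < Q a, Q a + 2 * ∑ a, |P a - Q a| := by
  rw [sum_filter, sum_filter, mul_sum, ← sum_add_distrib]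
  refine sum_le_sum fun a _ ↦ ?_
  have habs := le_abs_self (P a - Q a)
  have hQa : 0 ≤ Q a := hQ a
  split_ifs <;> linarith [abs_nonneg (P a - Q a)]

lemma SimulationCode.one_le_error_add [Nontrivial (Fin t)] (hRs : ∀ j, 0 ≤ Rs j)
    (c : SimulationCode (foreheadAccess t) (fun _ ↦ α) n R Rs) (p : PMF α) {S : Finset (Fin t)}
    (hS : S ≠ univ) {κ : ℝ} (hκ : 0 ≤ κ) :
    1 ≤ (t + 3) * c.error (p.map (Function.const (Fin t))) +
      ∑ y : Fin n → α with κ < iidMass p y, iidMass p y +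
      ((∏ j ∈ S, (indexCount n (Rs j) : ℝ)) * (2 * κ)) ^ (#Sᶜ : ℝ)⁻¹ * indexCount n R := by
  have : NeZero t := ⟨Fin.pos_iff_nonempty.2 inferInstance |>.ne'⟩
  let P (y : Fin n → α) : ℝ := c.induced (Function.const (Fin t) y)
  let δ : ℝ := c.error (p.map (Function.const (Fin t)))
  have hδ : ∑ y, |P y - iidMass p y| ≤ δ := c.sum_abs_induced_const_sub_le_error p
  have htotal : 1 - δ ≤ ∑ y, P y := by
    have := (neg_le_abs _).trans (abs_sum_le_sum_abs (fun y ↦ P y - iidMass p y) univ)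
    rw [sum_sub_distrib, sum_iidMass] at this
    linarith
  have hlarge : ∑ y with 2 * κ < P y, P y ≤ ∑ y with κ < iidMass p y, iidMass p y + 2 * δ :=
    (sum_filter_two_mul_lt_le (iidMass_nonneg p) κ).trans (by gcongr)
  have hsmall := c.sum_induced_const_add_le hRs hS (G := {y | ¬2 * κ < P y}) (K := 2 * κ)
    (by positivity) fun y hy ↦ not_lt.1 (mem_filter.1 hy).2
  have hsplit := sum_filter_add_sum_filter_not univ (fun y ↦ 2 * κ < P y) P
  have ht := mul_le_mul_of_nonneg_left htotal (Nat.cast_nonneg' t)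
  linarith

lemma prod_indexCount_mul_rpow_inv_card_mul_le {S : Finset (Fin t)} (hS : S ≠ univ)
    (θ : ℝ) :
    ((∏ j ∈ S, (indexCount n (Rs j) : ℝ)) * (2 * 2 ^ (-(n * θ)))) ^ (#Sᶜ : ℝ)⁻¹ * indexCount n R ≤
      2 ^ (#Sᶜ : ℝ)⁻¹ * (2 ^ ((#Sᶜ * R + ∑ j ∈ S, Rs j - θ) * (#Sᶜ : ℝ)⁻¹)) ^ n := by
  have hcard : (#Sᶜ : ℝ) ≠ 0 := by simpa [sub_eq_zero, eq_comm] using hS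
  calc
    _ ≤ ((∏ j ∈ S, (2 : ℝ) ^ (n * Rs j)) * (2 * 2 ^ (-(n * θ)))) ^ (#Sᶜ : ℝ)⁻¹ * 2 ^ (n * R) := by
      gcongr with j _
      · exact indexCount_le_rpow n (Rs j)
      · exact indexCount_le_rpow n R
    _ = 2 ^ (#Sᶜ : ℝ)⁻¹ * (2 ^ ((n * ∑ j ∈ S, Rs j - n * θ) * (#Sᶜ : ℝ)⁻¹) * 2 ^ (n * R)) := by
      rw [← Real.rpow_sum_of_pos two_pos, ← mul_sum, mul_left_comm,
        Real.mul_rpow two_pos.le (by positivity), ← Real.rpow_add two_pos,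
        ← Real.rpow_mul two_pos.le, ← sub_eq_add_neg, mul_assoc]
    _ = _ := by
      rw [← Real.rpow_add two_pos, ← Real.rpow_mul_natCast two_pos.le]
      congr 2
      field_simp
      ring

lemma entropy_le_of_achievable [Nontrivial (Fin t)] {p : PMF α} {r : ℝ × (Fin t → ℝ)}
    (hr : Achievable (foreheadAccess t) (p.map (Function.const (Fin t))) r) {S : Finset (Fin t)}
    (hS : S ≠ univ) : shannonEntropy p ≤ #Sᶜ * r.1 + ∑ j ∈ S, r.2 j := by
  obtain ⟨-, hRs, c, hc⟩ := hr
  by_contra! hlt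
  obtain ⟨θ, hθ, hθH⟩ := exists_between hlt
  have hcard : 0 < (#Sᶜ : ℝ) := by simpa [card_pos, nonempty_iff_ne_empty] using hS
  have hratio : (2 : ℝ) ^ ((#Sᶜ * r.1 + ∑ j ∈ S, r.2 j - θ) * (#Sᶜ : ℝ)⁻¹) < 1 :=
    Real.rpow_lt_one_of_one_lt_of_neg one_lt_two
      (mul_neg_of_neg_of_pos (sub_neg.2 hθ) (inv_pos.2 hcard))
  have hlim := ((hc.const_mul (t + 3 : ℝ)).add (tendsto_sum_iidMass_gt_rpow hθH)).add
    ((tendsto_pow_atTop_nhds_zero_of_lt_one (by positivity) hratio).const_mul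
      ((2 : ℝ) ^ (#Sᶜ : ℝ)⁻¹))
  have hone := ge_of_tendsto' hlim fun n ↦
    ((c n).one_le_error_add hRs p hS (κ := 2 ^ (-(n * θ))) (by positivity)).trans
      (add_le_add_right (prod_indexCount_mul_rpow_inv_card_mul_le hS θ) _)
  norm_num at hone

end ForeheadConverse

section ModularSum

variable {t : ℕ}

/-- The residues of the sources modulo `a`. -/
def residues (a : ℕ) {N : Fin t → ℕ} (w : ∀ j, Fin (N j)) (j : Fin t) : ZMod a := (w j : ℕ)

/-- Processor `i` recovers the residue of the source on its forehead by subtracting the residues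
that it observes from the sum `s` of all of them. -/
def recoverResidues (a : ℕ) {N : Fin t → ℕ} (i : Fin t) (s : ZMod a)
    (w : ∀ j : {j : Fin t // j ∈ foreheadAccess t i}, Fin (N j.1)) (j : Fin t) : ZMod a :=
  if h : j ∈ foreheadAccess t i then ((w ⟨j, h⟩ : ℕ) : ZMod a) else s - ∑ k, ((w k : ℕ) : ZMod a)

lemma recoverResidues_sum_residues (a : ℕ) {N : Fin t → ℕ} (i : Fin t) (w : ∀ j, Fin (N j)) :
    recoverResidues a i (∑ j, residues a w j) (fun j ↦ w j.1) = residues a w := by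
  funext j
  rw [recoverResidues]
  split_ifs with hj
  · rfl
  · obtain rfl : j = i := by simpa [foreheadAccess] using hj
    have hsum : ∑ k : {k // k ∈ foreheadAccess t j}, ((w k : ℕ) : ZMod a) =
        ∑ k ∈ univ \ {j}, residues a w k := sum_coe_sort (foreheadAccess t j) (residues a w)
    rw [hsum, ← sum_sdiff (subset_univ {j}), sum_singleton, add_sub_cancel_left]

/-- The law of the residues modulo `a` of independent uniform sources, together with an independent
uniform index in `Fin b`: this is what the processors have in common in the modular-sum code. -/
noncomputable def residueLaw (a b : ℕ) (N : Fin t → ℕ) [∀ j, NeZero (N j)] [NeZero b] :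
    PMF ((Fin t → ZMod a) × Fin b) :=
  (PMF.uniformOfFintype ((∀ j, Fin (N j)) × Fin b)).map (Prod.map (residues a) id)

variable {α : Type*} {n : ℕ} {R : ℝ} {Rs : Fin t → ℝ}

/-- The modular-sum code: the message encodes, through `φ`, the sum of the residues of the sources
modulo `a` and a fresh uniform index in `Fin b`; every processor decodes the message through `ψ`,
recovers all the residues, and applies `g` to them and to the index. -/
noncomputable def modularSumCode (a b : ℕ) [NeZero b] (φ : ZMod a × Fin b → Fin (indexCount n R))
    (ψ : Fin (indexCount n R) → ZMod a × Fin b) (g : (Fin t → ZMod a) × Fin b → Fin n → α) :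
    SimulationCode (foreheadAccess t) (fun _ ↦ α) n R Rs where
  encoder w := (PMF.uniformOfFintype (Fin b)).map fun e ↦ φ (∑ j, residues a w j, e)
  decoder i m w :=
    PMF.pure (g (recoverResidues (N := fun j ↦ indexCount n (Rs j)) a i (ψ m).1 w, (ψ m).2))

section Induced

variable {a b : ℕ} [NeZero b] [∀ j, NeZero (indexCount n (Rs j))]
  {φ : ZMod a × Fin b → Fin (indexCount n R)} {ψ : Fin (indexCount n R) → ZMod a × Fin b}

lemma induced_modularSumCode (hφ : Function.LeftInverse ψ φ)
    (g : (Fin t → ZMod a) × Fin b → Fin n → α) (x : Fin t → Fin n → α) :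
    (modularSumCode (Rs := Rs) a b φ ψ g).induced x =
      (((residueLaw a b fun j ↦ indexCount n (Rs j)).map g).map (Function.const (Fin t))
        x).toReal := by
  classical
  rw [residueLaw, PMF.map_comp, PMF.map_comp, toReal_pmf_map_apply, sum_filter,
    Fintype.sum_prod_type, SimulationCode.induced]
  refine sum_congr rfl fun w _ ↦ ?_
  simp only [SimulationCode.joint, mul_assoc, ← mul_sum]
  rw [modularSumCode, sum_toReal_pmf_map_mul]
  simp only [hφ _, recoverResidues_sum_residues, mul_sum]
  refine sum_congr rfl fun e _ ↦ ?_
  simp only [PMF.pure_apply, PMF.uniformOfFintype_apply, apply_ite ENNReal.toReal,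
    ENNReal.toReal_zero, prod_ite_zero, Function.comp_apply, Prod.map_apply, id, funext_iff,
    Function.const_apply, eq_comm (a := x _)]
  simp [mul_comm]

lemma induced_modularSumCode_const [NeZero t] (hφ : Function.LeftInverse ψ φ)
    (g : (Fin t → ZMod a) × Fin b → Fin n → α) (y : Fin n → α) :
    (modularSumCode (Rs := Rs) a b φ ψ g).induced (Function.const (Fin t) y) =
      ((residueLaw a b fun j ↦ indexCount n (Rs j)).map g y).toReal := by
  rw [induced_modularSumCode hφ, pmf_map_apply_of_injective _ Function.const_injective]

lemma induced_modularSumCode_eq_zero (hφ : Function.LeftInverse ψ φ)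
    (g : (Fin t → ZMod a) × Fin b → Fin n → α) {x : Fin t → Fin n → α}
    (hx : x ∉ Set.range (Function.const (Fin t))) :
    (modularSumCode (Rs := Rs) a b φ ψ g).induced x = 0 := by
  rw [induced_modularSumCode hφ, ENNReal.toReal_eq_zero_iff, PMF.apply_eq_zero_iff]
  left
  rintro h
  obtain ⟨y, -, hy⟩ := (PMF.mem_support_map_iff _ _ _).1 h
  exact hx ⟨y, hy⟩

lemma exists_error_modularSumCode_le [Fintype α] [NeZero t] [NeZero a]
    (hφ : Function.LeftInverse ψ φ) (p : PMF α) {η : ℝ} (hη : 0 ≤ η)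
    (hmass : ∀ v, ((residueLaw a b fun j ↦ indexCount n (Rs j)) v).toReal ≤ η) {θ : ℝ}
    (hθ : 0 < θ) :
    ∃ g, (modularSumCode (Rs := Rs) a b φ ψ g).error (p.map (Function.const (Fin t))) ≤
      2 * (θ⁻¹ * η + ∑ y : Fin n → α with iidMass p y ≤ θ, iidMass p y) := by
  classical
  have : Nonempty α := ⟨p.support_nonempty.some⟩
  obtain ⟨g, hg⟩ := exists_map_le_sum_fiber_add hη (fun _ ↦ ENNReal.toReal_nonneg) hmass univ
    (iidMass_nonneg p (n := n)) (by rw [sum_iidMass, sum_toReal_pmf_eq_one])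
  simp only [← toReal_pmf_map_apply] at hg
  refine ⟨g, ?_⟩
  rw [SimulationCode.error_eq_sum_abs_induced_const_sub _ _ fun x ↦
    induced_modularSumCode_eq_zero hφ g]
  simp only [induced_modularSumCode_const hφ]
  refine (sum_abs_sub_le_of_le_add (fun _ ↦ ENNReal.toReal_nonneg) (iidMass_nonneg p)
    (by rw [sum_toReal_pmf_eq_one, sum_iidMass]) hη hg {y | θ < iidMass p y}).trans ?_
  simp only [compl_filter, not_lt]
  gcongr
  exact card_filter_lt_le_inv (iidMass_nonneg p) (sum_iidMass p n) hθ

end Induced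

lemma card_filter_natCast_zmod_le (N : ℕ) {a : ℕ} [NeZero a] (u : ZMod a) :
    #{k : Fin N | ((k : ℕ) : ZMod a) = u} ≤ N / a + 1 := by
  have hcount : #{k : Fin N | ((k : ℕ) : ZMod a) = u} = N.count (· ≡ u.val [MOD a]) := by
    simp_rw [Nat.count_eq_card_filter_range, card_filter, sum_range,
      ← ZMod.natCast_eq_natCast_iff, ZMod.natCast_zmod_val]
  rw [hcount, Nat.count_modEq_card N (NeZero.pos a)]
  split_ifs <;> omega

lemma card_filter_natCast_zmod_mul_inv_le {N a : ℕ} [NeZero N] [NeZero a] (u : ZMod a) :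
    #{k : Fin N | ((k : ℕ) : ZMod a) = u} * (N : ℝ)⁻¹ ≤ 2 * ((min a N : ℕ) : ℝ)⁻¹ := by
  have hcard : #{k : Fin N | ((k : ℕ) : ZMod a) = u} * min a N ≤ 2 * N := calc
    _ ≤ (N / a + 1) * min a N := Nat.mul_le_mul_right _ (card_filter_natCast_zmod_le N u)
    _ ≤ N / a * a + N := by
      rw [add_mul, one_mul]
      gcongr <;> simp
    _ ≤ 2 * N := by linarith [Nat.div_mul_le_self N a]
  have hmin : 0 < min a N := lt_min (NeZero.pos a) (NeZero.pos N)
  rw [← div_eq_mul_inv, ← div_eq_mul_inv,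
    div_le_div_iff₀ (Nat.cast_pos.2 (NeZero.pos N)) (Nat.cast_pos.2 hmin)]
  exact_mod_cast hcard

lemma toReal_residueLaw_apply (a b : ℕ) (N : Fin t → ℕ) [∀ j, NeZero (N j)] [NeZero b]
    (u : Fin t → ZMod a) (e : Fin b) :
    (residueLaw a b N (u, e)).toReal =
      (∏ j, #{k : Fin (N j) | ((k : ℕ) : ZMod a) = u j} * (N j : ℝ)⁻¹) * (b : ℝ)⁻¹ := by
  have hfiber : ({z | Prod.map (residues a) id z = (u, e)} : Finset ((∀ j, Fin (N j)) × Fin b)) =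
      Fintype.piFinset (fun j ↦ {k : Fin (N j) | ((k : ℕ) : ZMod a) = u j}) ×ˢ {e} := by
    ext ⟨w, e'⟩
    simp only [mem_filter_univ, Prod.map_apply, Prod.mk.injEq, id, mem_product,
      Fintype.mem_piFinset, mem_singleton, funext_iff, residues]
  rw [residueLaw, toReal_pmf_map_apply, hfiber]
  simp [prod_mul_distrib, mul_assoc, mul_comm]

lemma toReal_residueLaw_apply_le (a b : ℕ) (N : Fin t → ℕ) [∀ j, NeZero (N j)] [NeZero a]
    [NeZero b] (v : (Fin t → ZMod a) × Fin b) :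
    (residueLaw a b N v).toReal ≤ (∏ j, 2 * ((min a (N j) : ℕ) : ℝ)⁻¹) * (b : ℝ)⁻¹ := by
  rw [toReal_residueLaw_apply]
  exact mul_le_mul_of_nonneg_right (prod_le_prod (fun j _ ↦ by positivity)
    fun j _ ↦ card_filter_natCast_zmod_mul_inv_le (v.1 j)) (by positivity)

lemma prod_two_mul_inv_indexCount_mul_inv_le (hR : 0 ≤ R) (hRs : ∀ j, 0 ≤ Rs j) {j₀ : Fin t}
    {b : ℕ} [NeZero b]
    (hb : indexCount n R ≤ 2 * (indexCount n (min R (Rs j₀)) * b)) :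
    (∏ j, 2 * (indexCount n (min R (Rs j)) : ℝ)⁻¹) * (b : ℝ)⁻¹ ≤
      8 * 4 ^ (t - 1) * 2 ^ (-(n * (R + ∑ j ∈ univ.erase j₀, min R (Rs j)))) := by
  have hmin (j : Fin t) : 0 ≤ min R (Rs j) := le_min hR (hRs j)
  have hinv : (b : ℝ)⁻¹ * (indexCount n (min R (Rs j₀)) : ℝ)⁻¹ ≤ 2 * (2 * 2 ^ (-(n * R))) := by
    refine le_trans ?_ (mul_le_mul_of_nonneg_left (inv_indexCount_le n hR) two_pos.le)
    have hcast : (indexCount n R : ℝ) ≤ 2 * (indexCount n (min R (Rs j₀)) * b) := by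
      exact_mod_cast hb
    rw [← mul_inv, ← div_eq_mul_inv, inv_eq_one_div, div_le_div_iff₀
      (mul_pos (Nat.cast_pos.2 (NeZero.pos b)) (Nat.cast_pos.2 (indexCount_pos n (hmin j₀))))
      (Nat.cast_pos.2 (indexCount_pos n hR))]
    linarith
  calc
    _ = 2 * ((b : ℝ)⁻¹ * (indexCount n (min R (Rs j₀)) : ℝ)⁻¹) *
        ∏ j ∈ univ.erase j₀, 2 * (indexCount n (min R (Rs j)) : ℝ)⁻¹ := by
      rw [← mul_prod_erase _ _ (mem_univ j₀)]
      ring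
    _ ≤ 2 * (2 * (2 * 2 ^ (-(n * R)))) *
        ∏ j ∈ univ.erase j₀, 2 * (2 * 2 ^ (-(n * min R (Rs j)))) :=
      mul_le_mul (mul_le_mul_of_nonneg_left hinv two_pos.le)
        (prod_le_prod (fun j _ ↦ by positivity) fun j _ ↦
          mul_le_mul_of_nonneg_left (inv_indexCount_le n (hmin j)) two_pos.le)
        (prod_nonneg fun j _ ↦ by positivity) (by positivity)
    _ = _ := by
      simp only [← mul_assoc, prod_mul_distrib, prod_const, card_erase_of_mem (mem_univ _),
        card_univ, Fintype.card_fin, ← mul_pow]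
      rw [← Real.rpow_sum_of_pos two_pos, sum_neg_distrib, ← mul_sum, mul_add, neg_add,
        Real.rpow_add two_pos]
      ring

lemma exists_error_le [Fintype α] [NeZero t] (p : PMF α) (n : ℕ) (hR : 0 ≤ R)
    (hRs : ∀ j, 0 ≤ Rs j) {j₀ : Fin t} (hj₀ : ∀ j, Rs j ≤ Rs j₀) (θ : ℝ) :
    ∃ c : SimulationCode (foreheadAccess t) (fun _ ↦ α) n R Rs,
      c.error (p.map (Function.const (Fin t))) ≤
        2 * (8 * 4 ^ (t - 1) * (2 ^ (θ - (R + ∑ j ∈ univ.erase j₀, min R (Rs j)))) ^ n +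
          ∑ y : Fin n → α with iidMass p y ≤ 2 ^ (-(n * θ)), iidMass p y) := by
  have (j : Fin t) : NeZero (indexCount n (Rs j)) := ⟨(indexCount_pos n (hRs j)).ne'⟩
  obtain ⟨a, ha⟩ : ∃ a, a = indexCount n (min R (Rs j₀)) := ⟨_, rfl⟩
  obtain ⟨b, hb⟩ : ∃ b, b = indexCount n R / a := ⟨_, rfl⟩
  have : NeZero a := ⟨ha ▸ (indexCount_pos n (le_min hR (hRs j₀))).ne'⟩
  have : NeZero b :=
    ⟨hb ▸ (Nat.div_pos (ha ▸ indexCount_mono n (min_le_left _ _)) (NeZero.pos a)).ne'⟩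
  have hab : indexCount n R ≤ 2 * (a * b) := by
    have hlt := Nat.lt_mul_div_succ (indexCount n R) (NeZero.pos a)
    rw [← hb, mul_add_one] at hlt
    linarith [Nat.le_mul_of_pos_right a (NeZero.pos b)]
  have hmass (v : (Fin t → ZMod a) × Fin b) :
      (residueLaw a b (fun j ↦ indexCount n (Rs j)) v).toReal ≤
        8 * 4 ^ (t - 1) * 2 ^ (-(n * (R + ∑ j ∈ univ.erase j₀, min R (Rs j)))) := by
    refine (toReal_residueLaw_apply_le a b (fun j ↦ indexCount n (Rs j)) v).trans ?_
    simp only [ha, ← (indexCount_mono n).map_min, min_assoc, min_eq_right (hj₀ _)]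
    exact prod_two_mul_inv_indexCount_mul_inv_le hR hRs (ha ▸ hab)
  obtain ⟨φ⟩ : Nonempty (ZMod a × Fin b ↪ Fin (indexCount n R)) :=
    Function.Embedding.nonempty_of_card_le (by simp [ZMod.card, hb, Nat.mul_div_le])
  obtain ⟨g, hg⟩ := exists_error_modularSumCode_le (Function.leftInverse_invFun φ.injective) p
    (by positivity) hmass (θ := 2 ^ (-(n * θ))) (by positivity)
  refine ⟨_, hg.trans_eq ?_⟩
  rw [← Real.rpow_neg two_pos.le, neg_neg, mul_left_comm, ← Real.rpow_add two_pos,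
    ← Real.rpow_mul_natCast two_pos.le, sub_mul, mul_comm (n : ℝ), mul_comm (n : ℝ),
    ← sub_eq_add_neg]

lemma exists_sum_min_eq (R : ℝ) (Rs : Fin t → ℝ) (j₀ : Fin t) :
    ∃ S ≠ univ, R + ∑ j ∈ univ.erase j₀, min R (Rs j) = #Sᶜ * R + ∑ j ∈ S, Rs j := by
  let S : Finset (Fin t) := {j | j ≠ j₀ ∧ Rs j < R}
  have hS (j : Fin t) (hj : j ∈ S) : min R (Rs j) = Rs j :=
    min_eq_right (mem_filter.1 hj).2.2.le
  have hSc (j : Fin t) (hj : j ∈ Sᶜ.erase j₀) : min R (Rs j) = R := by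
    simp only [S, mem_erase, mem_compl, mem_filter_univ, not_and, not_lt] at hj
    exact min_eq_left (hj.2 hj.1)
  have hj₀ : j₀ ∈ Sᶜ := by simp [S]
  refine ⟨S, fun h ↦ by simp [h] at hj₀, ?_⟩
  have hunion : univ.erase j₀ = S ∪ Sᶜ.erase j₀ := by
    rw [← union_compl S, erase_union_distrib, erase_eq_of_notMem (mem_compl.1 hj₀)]
  rw [hunion, sum_union (disjoint_compl_right.mono_right (erase_subset _ _)), sum_congr rfl hS,
    sum_congr rfl hSc, sum_const, nsmul_eq_mul, card_erase_of_mem hj₀,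
    Nat.cast_pred (card_pos.2 ⟨j₀, hj₀⟩)]
  ring

lemma achievable_of_entropy_lt [Fintype α] [NeZero t] {p : PMF α} {r : ℝ × (Fin t → ℝ)}
    (hR : 0 ≤ r.1) (hRs : ∀ j, 0 ≤ r.2 j)
    (hH : ∀ S ≠ univ, shannonEntropy p < #Sᶜ * r.1 + ∑ j ∈ S, r.2 j) :
    Achievable (foreheadAccess t) (p.map (Function.const (Fin t))) r := by
  obtain ⟨j₀, hj₀⟩ := Finite.exists_max r.2
  obtain ⟨S, hS, hsum⟩ := exists_sum_min_eq r.1 r.2 j₀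
  have hlt := hH S hS
  rw [← hsum] at hlt
  obtain ⟨θ, hHθ, hθ⟩ := exists_between hlt
  choose c hc using fun n ↦ exists_error_le p n hR hRs hj₀ θ
  have hratio : (2 : ℝ) ^ (θ - (r.1 + ∑ j ∈ univ.erase j₀, min r.1 (r.2 j))) < 1 :=
    Real.rpow_lt_one_of_one_lt_of_neg one_lt_two (sub_neg.2 hθ)
  refine ⟨hR, hRs, c, squeeze_zero (fun n ↦ sum_nonneg fun x _ ↦ abs_nonneg _) hc ?_⟩
  simpa using (((tendsto_pow_atTop_nhds_zero_of_lt_one (by positivity) hratio).const_mul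
    (8 * 4 ^ (t - 1))).add (tendsto_sum_iidMass_le_rpow hHθ)).const_mul 2

end ModularSum

section RateRegion

variable {t : ℕ}

/-- The polyhedron of the rate tuples that satisfy the forehead inequalities for a common output of
entropy `H`; the number `i` that multiplies the message rate is encoded as `#Sᶜ`. -/
def foreheadRates (t : ℕ) (H : ℝ) : Set (ℝ × (Fin t → ℝ)) :=
  {r | 0 ≤ r.1 ∧ (∀ j, 0 ≤ r.2 j) ∧ ∀ S ≠ univ, H ≤ #Sᶜ * r.1 + ∑ j ∈ S, r.2 j}

lemma forall_ne_univ_iff_forall_card_eq {P : ℕ → Finset (Fin t) → Prop} :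
    (∀ S ≠ univ, P #Sᶜ S) ↔
      ∀ i : ℕ, 1 ≤ i → i ≤ t → ∀ S : Finset (Fin t), S ⊂ univ → #S = t - i → P i S := by
  constructor
  · intro h i _ hit S hSu hS
    have hi : #Sᶜ = i := by rw [card_compl, Fintype.card_fin, hS, Nat.sub_sub_self hit]
    exact hi ▸ h S hSu.ne
  · intro h S hS
    have hpos : 0 < #Sᶜ := card_pos.2 (by simpa [nonempty_iff_ne_empty] using hS)
    have hcard : #Sᶜ + #S = t := by rw [card_compl_add_card, Fintype.card_fin]
    exact h _ hpos (by omega) S (ssubset_univ_iff.2 hS) (by omega)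

lemma isClosed_foreheadRates (H : ℝ) : IsClosed (foreheadRates t H) := by
  simp only [foreheadRates, Set.ofPred_and, Set.ofPred_forall]
  exact (isClosed_le (by fun_prop) (by fun_prop)).inter
    ((isClosed_iInter fun j ↦ isClosed_le (by fun_prop) (by fun_prop)).inter
      (isClosed_iInter fun S ↦ isClosed_iInter fun _ ↦ isClosed_le (by fun_prop) (by fun_prop)))

lemma foreheadRates_subset_closure_achievable [NeZero t] {α : Type*} [Fintype α] (p : PMF α) :
    foreheadRates t (shannonEntropy p) ⊆
      closure {r | Achievable (foreheadAccess t) (p.map (Function.const (Fin t))) r} := by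
  rintro ⟨R, Rs⟩ ⟨hR, hRs, hH⟩
  have hlim : Tendsto (fun ε : ℝ ↦ (R + ε, fun j ↦ Rs j + ε)) (𝓝[>] 0) (𝓝 (R, Rs)) := by
    have hcont : Continuous fun ε : ℝ ↦ (R + ε, fun j ↦ Rs j + ε) := by fun_prop
    simpa using (hcont.tendsto 0).mono_left nhdsWithin_le_nhds
  refine mem_closure_of_tendsto hlim ?_
  filter_upwards [self_mem_nhdsWithin] with ε (hε : 0 < ε)
  refine achievable_of_entropy_lt (add_nonneg hR hε.le) (fun j ↦ add_nonneg (hRs j) hε.le)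
    fun S hS ↦ (hH S hS).trans_lt ?_
  have hcard : 0 < (#Sᶜ : ℝ) := by simpa [card_pos, nonempty_iff_ne_empty] using hS
  have hsum : ∑ j ∈ S, Rs j ≤ ∑ j ∈ S, (Rs j + ε) := sum_le_sum fun j _ ↦ by linarith
  linarith [mul_pos hcard hε]

end RateRegion

theorem mainTheorem9 {t : ℕ} (ht : 2 ≤ t) {α : Type*} [Fintype α]
    (q : PMF (Fin t → α)) (pX : PMF α) (hq : q = pX.map (fun (a : α) (_ : Fin t) => a)) :
    foreheadRegion q =
      {r : ℝ × (Fin t → ℝ) | 0 ≤ r.1 ∧ (∀ j, 0 ≤ r.2 j) ∧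
        ∀ i : ℕ, 1 ≤ i → i ≤ t → ∀ S : Finset (Fin t), S ⊂ Finset.univ → S.card = t - i →
          shannonEntropy pX ≤ (i : ℝ) * r.1 + ∑ j ∈ S, r.2 j} := by
  subst hq
  have : NeZero t := ⟨by omega⟩
  have : Nontrivial (Fin t) := Fin.nontrivial_iff_two_le.2 ht
  have hrates (r : ℝ × (Fin t → ℝ)) := forall_ne_univ_iff_forall_card_eq
    (P := fun i S ↦ shannonEntropy pX ≤ (i : ℝ) * r.1 + ∑ j ∈ S, r.2 j)
  simp only [← hrates]
  change closure _ = foreheadRates t (shannonEntropy pX)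
  refine Set.Subset.antisymm (closure_minimal ?_ (isClosed_foreheadRates _))
    (foreheadRates_subset_closure_achievable pX)
  exact fun r hr ↦ ⟨hr.1, hr.2.1, fun S hS ↦ entropy_le_of_achievable hr hS⟩
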